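/- Let $m,n\ge 0$ be integers and let $P(x)$ be an $m\times m$ matrix whose entries are real polynomials in $x=(x_1,\dots,x_n)$. Let $\mathcal G$ be a chordal (undirected, simple) graph with vertex set $\{1,\dots,m\}$, meaning that every cycle of length at least $4$ in $\mathcal G$ has a chord, i.e. an edge of $\mathcal G$ joining two nonconsecutive vertices of the cycle. Let $\mathcal C_1,\dots,\mathcal C_t$ be the distinct maximal cliques of $\mathcal G$. Suppose that the sparsity of $P$ is described by $\mathcal G$: $P_{ij}\equiv 0$ whenever $i\ne j$ and $\{i,j\}$ is not an edge of $\mathcal G$. Suppose moreover that - $P$ is homogeneous: all its entries are homogeneous polynomials of one common degree; - $P$ is even: in every monomial that occurs in an entry of $P$, each variable $x_i$ has an even exponent; - for every $x\in\mathbb R^n\setminus\{0\}$ the matrix $P(x)$ is symmetric and positive definite. Then there exist an integer $\nu\ge 0$ and SOS matrices $S_1(x),\dots,S_t(x)$, with $S_k$ of size $|\mathcal C_k|\times|\mathcal C_k|$, such that $$\left(x_1^2+\cdots+x_n^2\right)^{\nu} P(x)=\sum_{k=1}^{t} E_{\mathcal C_k}^{\mathsf T}\, S_k(x)\, E_{\mathcal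 C_k}.$$ Here a square polynomial matrix $S(x)$ is called SOS if $S(x)=H(x)^{\mathsf T}H(x)$ for some polynomial matrix $H(x)$ with any number of rows, and $E_{\mathcal C_k}$ is the $|\mathcal C_k|\times m$ matrix whose $(i,j)$ entry is $1$ if $j$ is the $i$-th element of $\mathcal C_k$ in increasing order and $0$ otherwise. -/

import Mathlib

namespace ChordalSOS

/-- A graph is chordal if every cycle of length at least four has a chord, that is, an edge of
the graph which joins two nonconsecutive vertices of the cycle. (Cycles have pairwise distinct
vertices, so two adjacent vertices of the cycle are nonconsecutive exactly when the edge that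
joins them is not an edge of the cycle.) -/
def IsChordal {V : Type*} (G : SimpleGraph V) : Prop :=
  ∀ (v : V) (c : G.Walk v v), c.IsCycle → 4 ≤ c.length →
    ∃ a b : V, a ∈ c.support ∧ b ∈ c.support ∧ G.Adj a b ∧ s(a, b) ∉ c.edges

/-- A maximal clique: a clique that is not properly contained in any other clique. -/
def IsMaximalClique {V : Type*} (G : SimpleGraph V) (C : Finset V) : Prop :=
  Maximal (fun D : Finset V => G.IsClique (D : Set V)) C

/-- An `m × m` matrix of real polynomials in `n` variables. -/
abbrev PolyMatrix (n m : ℕ) : Type :=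
  Matrix (Fin m) (Fin m) (MvPolynomial (Fin n) ℝ)

/-- The sparsity of `P` is described by the graph `G`: the off-diagonal entries of `P` at
positions that are not edges of `G` vanish identically. -/
def HasSparsityGraph {n m : ℕ} (P : PolyMatrix n m) (G : SimpleGraph (Fin m)) : Prop :=
  ∀ i j : Fin m, i ≠ j → ¬ G.Adj i j → P i j = 0

/-- `P` is homogeneous: all its entries are homogeneous of one common degree. -/
def IsHomogeneous {n m : ℕ} (P : PolyMatrix n m) : Prop :=
  ∃ d : ℕ, ∀ i j : Fin m, (P i j).IsHomogeneous d

/-- `P` is even: it contains only monomials in which each variable has an even exponent. -/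
def IsEven {n m : ℕ} (P : PolyMatrix n m) : Prop :=
  ∀ i j : Fin m, ∀ α ∈ (P i j).support, ∀ l : Fin n, Even (α l)

/-- The value `P(x)` of a polynomial matrix at a point `x` of `ℝⁿ`. -/
noncomputable def evalAt {n m : ℕ} (P : PolyMatrix n m) (x : Fin n → ℝ) :
    Matrix (Fin m) (Fin m) ℝ :=
  P.map (MvPolynomial.eval x)

/-- `S` is an SOS matrix: `S = Hᵀ H` for some (rectangular) polynomial matrix `H`. -/
def IsSOS {n m : ℕ} (S : PolyMatrix n m) : Prop :=
  ∃ (r : ℕ) (H : Matrix (Fin r) (Fin m) (MvPolynomial (Fin n) ℝ)), S = H.transpose * H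

/-- The `|C| × m` inflation matrix `E_C`: its `(i, j)` entry is `1` if `j` is the `i`-th
element of `C` in increasing order, and `0` otherwise. -/
def inflation {m : ℕ} (R : Type*) [Zero R] [One R] (C : Finset (Fin m)) :
    Matrix (Fin C.card) (Fin m) R :=
  Matrix.of fun i j => if C.orderEmbOfFin rfl i = j then 1 else 0

end ChordalSOS

/-! As `P` is even, `P(x) = Q(x₁², …, xₙ²)`, with `Q` homogeneous and positive definite on the
nonnegative orthant minus the origin. The matrix form of Pólya's theorem (`exists_posSemidef_coeff`)
gives `N` for which every coefficient matrix of `(X₁ + ⋯ + Xₙ)^N Q` is positive semidefinite.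
Substituting squares back, `(∑ xᵢ²)^N P` is a sum of terms `x^(2α) A_α` with constant `A_α ⪰ 0` that
inherit the sparsity of `P`.

For constant matrices chordality suffices (`IsChordal.mem_closure_cliqueRankOnes`): eliminating a
simplicial vertex splits off some `w wᵀ` supported on a clique and creates no fill-in. Finally
`x^(2α) w wᵀ = (x^α w)(x^α w)ᵀ` is SOS and fits in the block of a maximal clique. -/

namespace ChordalSOS

/-! ### Chordal graphs and simplicial vertices -/

/-- The edges of `G` with both ends in `T`, as a graph on all vertices. -/
def restrictTo {V : Type*} (G : SimpleGraph V) (T : Set V) : SimpleGraph V where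
  Adj a b := G.Adj a b ∧ a ∈ T ∧ b ∈ T
  symm := ⟨fun _ _ h => ⟨h.1.symm, h.2.2, h.2.1⟩⟩
  loopless := ⟨fun _ h => h.1.ne rfl⟩

lemma restrictTo_le {V : Type*} (G : SimpleGraph V) (T : Set V) : restrictTo G T ≤ G :=
  fun _ _ h => h.1

lemma restrictTo_mono {V : Type*} (G : SimpleGraph V) {T U : Set V} (h : T ⊆ U) :
    restrictTo G T ≤ restrictTo G U :=
  fun _ _ hab => ⟨hab.1, h hab.2.1, h hab.2.2⟩

lemma mem_of_mem_support_restrictTo {V : Type*} {G : SimpleGraph V} {T : Set V} {a b : V}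
    (p : (restrictTo G T).Walk a b) (ha : a ∈ T) {c : V} (hc : c ∈ p.support) : c ∈ T := by
  induction p with
  | nil => simp_all
  | cons h p ih =>
    rw [SimpleGraph.Walk.support_cons, List.mem_cons] at hc
    rcases hc with rfl | hc
    · exact ha
    · exact ih h.2.2 hc

lemma mem_of_reachable_restrictTo {V : Type*} {G : SimpleGraph V} {T : Set V} {a b : V}
    (h : (restrictTo G T).Reachable a b) (ha : a ∈ T) : b ∈ T :=
  h.elim fun p => mem_of_mem_support_restrictTo p ha p.end_mem_support

/-- A walk of minimal length has no chord. -/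
lemma mem_edges_of_length_eq_dist {V : Type*} {G : SimpleGraph V} {x y : V} (p : G.Walk x y)
    (hp : p.length = G.dist x y) {a b : V} (ha : a ∈ p.support) (hb : b ∈ p.support)
    (hab : G.Adj a b) : s(a, b) ∈ p.edges := by
  have key : ∀ i j : ℕ, i < j → j ≤ p.length → G.Adj (p.getVert i) (p.getVert j) →
      s(p.getVert i, p.getVert j) ∈ p.edges := by
    intro i j hij hj h
    -- Short-cutting along the chord cannot beat the distance, which forces `j = i + 1`.
    have hd := G.dist_le ((p.take i).append (SimpleGraph.Walk.cons h (p.drop j)))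
    simp only [SimpleGraph.Walk.length_append, SimpleGraph.Walk.length_cons,
      SimpleGraph.Walk.take_length, SimpleGraph.Walk.drop_length] at hd
    obtain rfl : j = i + 1 := by omega
    have hi : i < p.edges.length := by rw [SimpleGraph.Walk.length_edges]; omega
    have := List.getElem_mem hi
    simpa [SimpleGraph.Walk.getElem_edges] using this
  obtain ⟨i, rfl, hi⟩ := SimpleGraph.Walk.mem_support_iff_exists_getVert.1 ha
  obtain ⟨j, rfl, hj⟩ := SimpleGraph.Walk.mem_support_iff_exists_getVert.1 hb
  rcases lt_trichotomy i j with h | rfl | h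
  · exact key i j h hj hab
  · exact (hab.ne rfl).elim
  · rw [Sym2.eq_swap]
    exact key j i h hi hab.symm

/-- In a chordal graph, two neighbours of `v` that are attached to one component of the
graph of non-neighbours of `v` are adjacent. -/
lemma IsChordal.adj_of_reachable {V : Type*} {G : SimpleGraph V} (hG : IsChordal G) {v : V}
    {W : Set V} (hW : ∀ w ∈ W, w ≠ v ∧ ¬ G.Adj v w) {x y k l : V} (hvx : G.Adj v x)
    (hvy : G.Adj v y) (hk : k ∈ W) (hl : l ∈ W) (hxk : G.Adj x k) (hyl : G.Adj y l)
    (hkl : (restrictTo G W).Reachable k l) (hxy : x ≠ y) : G.Adj x y := by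
  by_contra hnot
  -- A shortest path from `x` to `y` inside `T` is chordless, and only its ends are adjacent to `v`.
  -- If `x`, `y` were not adjacent, closing it through `v` would give a chordless cycle of length at
  -- least 4.
  set T : Set V := W ∪ {x, y} with hT
  have hWT : W ⊆ T := Set.subset_union_left
  have hxT : x ∈ T := by simp [hT]
  have hyT : y ∈ T := by simp [hT]
  have hTv : ∀ c ∈ T, c ≠ v ∧ (G.Adj v c → c = x ∨ c = y) := by
    rintro c (hc | rfl | rfl)
    · exact ⟨(hW c hc).1, fun h => ((hW c hc).2 h).elim⟩
    · exact ⟨hvx.ne', fun _ => Or.inl rfl⟩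
    · exact ⟨hvy.ne', fun _ => Or.inr rfl⟩
  have hr : (restrictTo G T).Reachable x y := by
    have h1 : (restrictTo G T).Adj x k := ⟨hxk, hxT, hWT hk⟩
    have h2 : (restrictTo G T).Adj l y := ⟨hyl.symm, hWT hl, hyT⟩
    exact h1.reachable.trans ((hkl.mono (restrictTo_mono G hWT)).trans h2.reachable)
  obtain ⟨p, hp, hlen⟩ := hr.exists_path_of_dist
  have hsupp : ∀ c ∈ p.support, c ∈ T := fun c hc => mem_of_mem_support_restrictTo p hxT hc
  have hlen2 : 2 ≤ p.length := by
    by_contra! h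
    have : p.length = 0 ∨ p.length = 1 := by omega
    rcases this with h0 | h1
    · exact hxy (SimpleGraph.Walk.eq_of_length_eq_zero h0)
    · exact hnot (restrictTo_le G T (SimpleGraph.Walk.adj_of_length_eq_one h1))
  have hle := restrictTo_le G T
  set q := p.mapLe hle with hq
  have hqp : q.IsPath := (SimpleGraph.Walk.isPath_mapLe hle).2 hp
  have hqs : q.support = p.support := by simp [hq]
  have hqe : q.edges = p.edges := by simp [hq]
  have hvq : v ∉ q.support := fun h => (hTv v (hsupp v (hqs ▸ h))).1 rfl
  have hcyc : (SimpleGraph.Walk.cons hvx (q.concat hvy.symm)).IsCycle := by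
    rw [SimpleGraph.Walk.cons_isCycle_iff, SimpleGraph.Walk.concat_isPath_iff]
    refine ⟨⟨hqp, hvq⟩, fun h => ?_⟩
    rw [SimpleGraph.Walk.edges_concat, List.concat_eq_append, List.mem_append] at h
    rcases h with h | h
    · exact hvq (q.fst_mem_support_of_mem_edges h)
    · simp only [List.mem_singleton, Sym2.eq_iff] at h
      rcases h with ⟨h, -⟩ | ⟨-, h⟩
      · exact hvy.ne h
      · exact hxy h
  obtain ⟨a, b, ha, hb, hab, hne⟩ := hG v _ hcyc (by
    simp only [SimpleGraph.Walk.length_cons, SimpleGraph.Walk.length_concat]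
    have : q.length = p.length := by simp [hq]
    omega)
  have hmem : ∀ c ∈ (SimpleGraph.Walk.cons hvx (q.concat hvy.symm)).support,
      c = v ∨ c ∈ p.support := by
    intro c hc
    simp only [SimpleGraph.Walk.support_cons, SimpleGraph.Walk.support_concat, hqs,
      List.mem_cons, List.mem_append, List.not_mem_nil, or_false] at hc
    tauto
  have hedge : ∀ e : Sym2 V, e = s(v, x) ∨ e ∈ p.edges ∨ e = s(y, v) →
      e ∈ (SimpleGraph.Walk.cons hvx (q.concat hvy.symm)).edges := by
    intro e he
    simpa only [SimpleGraph.Walk.edges_cons, SimpleGraph.Walk.edges_concat, hqe,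
      List.concat_eq_append, List.mem_cons, List.mem_append, List.not_mem_nil, or_false] using he
  have hv : ∀ c ∈ p.support, G.Adj v c →
      s(v, c) ∈ (SimpleGraph.Walk.cons hvx (q.concat hvy.symm)).edges := by
    intro c hc hvc
    rcases (hTv c (hsupp c hc)).2 hvc with rfl | rfl
    · exact hedge _ (Or.inl rfl)
    · exact hedge _ (Or.inr (Or.inr Sym2.eq_swap))
  apply hne
  rcases hmem a ha with rfl | ha' <;> rcases hmem b hb with rfl | hb'
  · exact (hab.ne rfl).elim
  · exact hv b hb' hab
  · rw [Sym2.eq_swap]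
    exact hv a ha' hab.symm
  · exact hedge _ (Or.inr (Or.inl (mem_edges_of_length_eq_dist p hlen ha' hb'
      ⟨hab, hsupp a ha', hsupp b hb'⟩)))

/-- The neighbours of `s` in `S` are pairwise adjacent. -/
def IsSimplicialIn {V : Type*} (G : SimpleGraph V) (S : Finset V) (s : V) : Prop :=
  ∀ a ∈ S, ∀ b ∈ S, G.Adj s a → G.Adj s b → a ≠ b → G.Adj a b

/-- In a chordal graph, every vertex that has non-neighbours has a simplicial one. -/
lemma IsChordal.exists_isSimplicialIn_not_adj {V : Type*} {G : SimpleGraph V}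
    (hG : IsChordal G) (S : Finset V) :
    ∀ v ∈ S, (∃ u ∈ S, u ≠ v ∧ ¬ G.Adj v u) →
      ∃ s ∈ S, s ≠ v ∧ ¬ G.Adj v s ∧ IsSimplicialIn G S s := by
  classical
  induction S using Finset.strongInduction with
  | H S ih =>
  rintro v hv ⟨u, hu, huv, hnu⟩
  set W : Set V := {w | w ∈ S ∧ w ≠ v ∧ ¬ G.Adj v w} with hWdef
  have huW : u ∈ W := ⟨hu, huv, hnu⟩
  -- `K` is a component of the non-neighbours of `v`, and `B`, its boundary among the neighbours of
  -- `v`, is a clique. The set `K ∪ B` misses `v`, so induction applies to it; it contains all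
  -- neighbours in `S` of vertices of `K`, so a vertex of `K` simplicial there is simplicial in `S`.
  set K : Set V := {w | (restrictTo G W).Reachable u w} with hK
  have huK : u ∈ K := SimpleGraph.Reachable.refl _
  have hKW : K ⊆ W := fun w hw => mem_of_reachable_restrictTo hw huW
  have hKadj : ∀ k ∈ K, ∀ w ∈ W, G.Adj k w → w ∈ K := fun k hk w hw hkw =>
    SimpleGraph.Reachable.trans hk
      (SimpleGraph.Adj.reachable (show (restrictTo G W).Adj k w from ⟨hkw, hKW hk, hw⟩))
  set B : Set V := {b | b ∈ S ∧ G.Adj v b ∧ ∃ k ∈ K, G.Adj b k} with hB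
  have hKB : ∀ k ∈ K, ∀ w ∈ S, G.Adj k w → w ∈ K ∨ w ∈ B := by
    intro k hk w hw hkw
    by_cases hvw : G.Adj v w
    · exact Or.inr ⟨hw, hvw, k, hk, hkw.symm⟩
    · refine Or.inl (hKadj k hk w ⟨hw, ?_, hvw⟩ hkw)
      rintro rfl
      exact (hKW hk).2.2 hkw.symm
  have hBclique : ∀ x ∈ B, ∀ y ∈ B, x ≠ y → G.Adj x y := by
    rintro x ⟨-, hvx, k, hk, hxk⟩ y ⟨-, hvy, l, hl, hyl⟩ hxy
    exact hG.adj_of_reachable (fun w hw => hw.2) hvx hvy (hKW hk) (hKW hl) hxk hyl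
      (SimpleGraph.Reachable.trans (SimpleGraph.Reachable.symm hk) hl) hxy
  set U : Finset V := S.filter fun w => w ∈ K ∨ w ∈ B with hU
  have hUS : U ⊂ S := by
    refine Finset.filter_ssubset.2 ⟨v, hv, ?_⟩
    rintro (h | h)
    · exact (hKW h).2.1 rfl
    · exact h.2.1.ne rfl
  have hmemU : ∀ w, w ∈ U ↔ w ∈ K ∨ w ∈ B := fun w => by
    rw [hU, Finset.mem_filter]
    exact ⟨And.right, fun h => ⟨h.elim (fun h => (hKW h).1) And.left, h⟩⟩
  suffices ∃ s ∈ K, IsSimplicialIn G U s by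
    obtain ⟨s, hs, hsimp⟩ := this
    refine ⟨s, (hKW hs).1, (hKW hs).2.1, (hKW hs).2.2, fun a ha b hb hsa hsb hab => ?_⟩
    exact hsimp a ((hmemU a).2 (hKB s hs a ha hsa)) b ((hmemU b).2 (hKB s hs b hb hsb)) hsa hsb hab
  -- A simplicial vertex not adjacent to some `b ∈ B` lies outside the clique `B`, hence in `K`.
  by_cases h1 : ∃ b ∈ B, ∃ w ∈ U, w ≠ b ∧ ¬ G.Adj b w
  · obtain ⟨b, hb, hw⟩ := h1
    obtain ⟨s, hs, hsb, hns, hsimp⟩ := ih U hUS b ((hmemU b).2 (Or.inr hb)) hw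
    refine ⟨s, ((hmemU s).1 hs).resolve_right fun h => hns (hBclique b hb s h hsb.symm), hsimp⟩
  · push Not at h1
    -- Now each vertex of `B` is adjacent to all the rest of `U`, so a non-neighbour of `k` lies in
    -- `K`. If there is none, `U` is a clique and `u` itself works.
    by_cases h2 : ∃ k ∈ K, ∃ w ∈ U, w ≠ k ∧ ¬ G.Adj k w
    · obtain ⟨k, hk, hw⟩ := h2
      have hkU := (hmemU k).2 (Or.inl hk)
      obtain ⟨s, hs, hsk, hns, hsimp⟩ := ih U hUS k hkU hw
      exact ⟨s, ((hmemU s).1 hs).resolve_right fun h => hns (h1 s h k hkU hsk.symm).symm, hsimp⟩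
    · push Not at h2
      refine ⟨u, huK, fun a ha b hb _ _ hab => ?_⟩
      rcases (hmemU a).1 ha with h | h
      · exact h2 a h b hb hab.symm
      · exact h1 a h b hb hab.symm

/-- Every nonempty set of vertices of a chordal graph has a simplicial vertex. -/
lemma IsChordal.exists_isSimplicialIn {V : Type*} {G : SimpleGraph V} (hG : IsChordal G)
    {S : Finset V} (hS : S.Nonempty) : ∃ s ∈ S, IsSimplicialIn G S s := by
  obtain ⟨v, hv⟩ := hS
  by_cases h : ∃ a ∈ S, ∃ u ∈ S, u ≠ a ∧ ¬ G.Adj a u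
  · obtain ⟨a, ha, hu⟩ := h
    obtain ⟨s, hs, -, -, hsimp⟩ := hG.exists_isSimplicialIn_not_adj S a ha hu
    exact ⟨s, hs, hsimp⟩
  · push Not at h
    exact ⟨v, hv, fun a ha b hb _ _ hab => h a ha b hb hab.symm⟩

/-! ### Rank one decomposition of sparse positive semidefinite matrices -/

open Matrix

/-- The rank one matrices `w wᵀ` for which the support of `w` is a clique of `G`. -/
def cliqueRankOnes {m : ℕ} (R : Type*) [Mul R] [Zero R] (G : SimpleGraph (Fin m)) :
    Set (Matrix (Fin m) (Fin m) R) :=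
  {A | ∃ w : Fin m → R, G.IsClique {i | w i ≠ 0} ∧ A = vecMulVec w w}

lemma posSemidef_iff_real {m : ℕ} {A : Matrix (Fin m) (Fin m) ℝ} :
    A.PosSemidef ↔ A.IsSymm ∧ ∀ x, 0 ≤ x ⬝ᵥ A *ᵥ x := by
  rw [posSemidef_iff_dotProduct_mulVec]
  simp only [star_trivial, IsHermitian, conjTranspose_eq_transpose_of_trivial, IsSymm]

lemma IsSymm.dotProduct_mulVec_sub_smul_single {m : ℕ} {A : Matrix (Fin m) (Fin m) ℝ}
    (hA : A.IsSymm) (x : Fin m → ℝ) (c : ℝ) (s : Fin m) :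
    (x - c • Pi.single s 1) ⬝ᵥ A *ᵥ (x - c • Pi.single s 1) =
      x ⬝ᵥ A *ᵥ x - 2 * c * (A s ⬝ᵥ x) + c ^ 2 * A s s := by
  have h1 : x ⬝ᵥ A *ᵥ Pi.single s 1 = A s ⬝ᵥ x := by
    rw [mulVec_single_one, dotProduct_comm]
    congr 1
    ext i
    exact hA.apply s i
  have h2 : (Pi.single s 1 : Fin m → ℝ) ⬝ᵥ A *ᵥ x = A s ⬝ᵥ x := by
    rw [single_one_dotProduct, mulVec]
  have h3 : (Pi.single s 1 : Fin m → ℝ) ⬝ᵥ A *ᵥ Pi.single s 1 = A s s := by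
    simp
  rw [mulVec_sub, mulVec_smul, dotProduct_sub, sub_dotProduct, sub_dotProduct, smul_dotProduct,
    dotProduct_smul, smul_dotProduct, dotProduct_smul, h1, h2, h3]
  simp only [smul_eq_mul]
  ring

/-- If a diagonal entry of a positive semidefinite matrix is zero, then so is its row. -/
lemma row_eq_zero_of_posSemidef {m : ℕ} {A : Matrix (Fin m) (Fin m) ℝ} (hA : A.PosSemidef)
    {s : Fin m} (hs : A s s = 0) (j : Fin m) : A s j = 0 := by
  obtain ⟨hsym, hnn⟩ := posSemidef_iff_real.1 hA
  by_contra h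
  -- The coefficient is chosen so that the quadratic form takes the value `-1`.
  have := hnn (Pi.single j 1 - ((A j j + 1) / (2 * A s j)) • Pi.single s 1)
  rw [IsSymm.dotProduct_mulVec_sub_smul_single hsym, hs] at this
  have h3 : (Pi.single j 1 : Fin m → ℝ) ⬝ᵥ A *ᵥ Pi.single j 1 = A j j := by simp
  rw [h3, dotProduct_single_one] at this
  have h4 : 2 * ((A j j + 1) / (2 * A s j)) * A s j = A j j + 1 := by field_simp
  linarith

/-- Symmetric Gaussian elimination of one row preserves positive semidefiniteness. -/
lemma posSemidef_sub_vecMulVec {m : ℕ} {A : Matrix (Fin m) (Fin m) ℝ} (hA : A.PosSemidef)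
    {s : Fin m} (hs : 0 < A s s) {w : Fin m → ℝ} (hw : ∀ i j, w i * w j = A s i * A s j / A s s) :
    (A - vecMulVec w w).PosSemidef := by
  obtain ⟨hsym, hnn⟩ := posSemidef_iff_real.1 hA
  refine posSemidef_iff_real.2 ⟨?_, fun x => ?_⟩
  · ext i j
    simp [vecMulVec_apply, hsym.apply i j, mul_comm]
  · have h1 := hnn (x - (A s ⬝ᵥ x / A s s) • Pi.single s 1)
    rw [IsSymm.dotProduct_mulVec_sub_smul_single hsym] at h1
    have h2 : x ⬝ᵥ vecMulVec w w *ᵥ x = (A s ⬝ᵥ x) ^ 2 / A s s := by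
      have : x ⬝ᵥ vecMulVec w w *ᵥ x = ∑ i, ∑ j, (w i * w j) * (x i * x j) := by
        simp only [dotProduct, mulVec, vecMulVec_apply, Finset.mul_sum]
        exact Finset.sum_congr rfl fun i _ => Finset.sum_congr rfl fun j _ => by ring
      rw [this, sq, dotProduct, Finset.sum_mul_sum, Finset.sum_div]
      refine Finset.sum_congr rfl fun i _ => ?_
      rw [Finset.sum_div]
      refine Finset.sum_congr rfl fun j _ => ?_
      rw [hw]
      ring
    rw [sub_mulVec, dotProduct_sub, h2]
    have h3 : x ⬝ᵥ A *ᵥ x - 2 * (A s ⬝ᵥ x / A s s) * (A s ⬝ᵥ x) + (A s ⬝ᵥ x / A s s) ^ 2 * A s s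
        = x ⬝ᵥ A *ᵥ x - (A s ⬝ᵥ x) ^ 2 / A s s := by
      field_simp
      ring
    linarith

/-- A positive semidefinite matrix whose sparsity is described by a chordal graph is a sum of
positive semidefinite rank one matrices that are supported on cliques. -/
lemma IsChordal.mem_closure_cliqueRankOnes {m : ℕ} {G : SimpleGraph (Fin m)} (hG : IsChordal G)
    (S : Finset (Fin m)) :
    ∀ A : Matrix (Fin m) (Fin m) ℝ, A.PosSemidef → (∀ i j, i ≠ j → ¬ G.Adj i j → A i j = 0) →
      (∀ i j, A i j ≠ 0 → i ∈ S) → A ∈ AddSubmonoid.closure (cliqueRankOnes ℝ G) := by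
  induction S using Finset.strongInduction with
  | H S ih =>
  intro A hA hsp hS
  rcases S.eq_empty_or_nonempty with rfl | hne
  · have : A = 0 := by
      ext i j
      by_contra h
      exact Finset.notMem_empty _ (hS i j h)
    exact this ▸ zero_mem _
  obtain ⟨s, hs, hsimp⟩ := hG.exists_isSimplicialIn hne
  have hsym := (posSemidef_iff_real.1 hA).1
  have hlt := Finset.erase_ssubset hs
  rcases (hA.diag_nonneg (i := s)).eq_or_lt with h0 | hpos
  · refine ih _ hlt A hA hsp fun i j hij => Finset.mem_erase.2 ⟨?_, hS i j hij⟩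
    rintro rfl
    exact hij (row_eq_zero_of_posSemidef hA h0.symm j)
  · set w : Fin m → ℝ := fun i => A s i / √(A s s) with hw
    have hww : ∀ i j, w i * w j = A s i * A s j / A s s := fun i j => by
      rw [hw, div_mul_div_comm, Real.mul_self_sqrt hpos.le]
    have hwA : ∀ i, w i ≠ 0 → A s i ≠ 0 := fun i hi h => hi (by simp [hw, h])
    -- The support of `w` consists of `s` and some of its neighbours in `S`, which are pairwise
    -- adjacent because `s` is simplicial. Hence subtracting `w wᵀ` respects the sparsity.
    have hclique : G.IsClique {i | w i ≠ 0} := by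
      intro i hi j hj hij
      have hi' := hwA i hi
      have hj' := hwA j hj
      have hiS : i ∈ S := hS i s (by rwa [hsym.apply s i])
      have hjS : j ∈ S := hS j s (by rwa [hsym.apply s j])
      have hadj : ∀ k, A s k ≠ 0 → s ≠ k → G.Adj s k := fun k hk hsk => by
        by_contra h
        exact hk (hsp s k hsk h)
      by_cases hsi : s = i
      · exact hsi ▸ hadj j hj' (hsi ▸ hij)
      by_cases hsj : s = j
      · exact hsj ▸ (hadj i hi' hsi).symm
      · exact hsimp i hiS j hjS (hadj i hi' hsi) (hadj j hj' hsj) hij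
    have hrest : A - vecMulVec w w ∈ AddSubmonoid.closure (cliqueRankOnes ℝ G) := by
      refine ih _ hlt _ (posSemidef_sub_vecMulVec hA hpos hww) (fun i j hij hnadj => ?_)
        fun i j hij => Finset.mem_erase.2 ⟨?_, ?_⟩
      · rw [Matrix.sub_apply, vecMulVec_apply, hsp i j hij hnadj, zero_sub, neg_eq_zero]
        by_contra h
        exact hnadj (hclique (left_ne_zero_of_mul h) (right_ne_zero_of_mul h) hij)
      · rintro rfl
        apply hij
        rw [Matrix.sub_apply, vecMulVec_apply, hww]
        field_simp
        ring
      · by_contra hi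
        have hz : ∀ j, A i j = 0 := fun j => by
          by_contra h
          exact hi (hS i j h)
        apply hij
        rw [Matrix.sub_apply, vecMulVec_apply, hww, hz j, ← hsym.apply s i, hz s]
        simp
    have := add_mem hrest (AddSubmonoid.subset_closure ⟨w, hclique, rfl⟩)
    rwa [sub_add_cancel] at this

/-! ### SOS matrices supported on cliques -/

/-- Matrices that are sums `∑ Eₖᵀ Sₖ Eₖ` with SOS matrices `Sₖ`. -/
def IsSOSDecomposable {n m t : ℕ} (C : Fin t → Finset (Fin m)) (M : PolyMatrix n m) : Prop :=
  ∃ S : (k : Fin t) → PolyMatrix n (C k).card, (∀ k, IsSOS (S k)) ∧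
    M = ∑ k : Fin t, (inflation (MvPolynomial (Fin n) ℝ) (C k)).transpose * S k *
      inflation (MvPolynomial (Fin n) ℝ) (C k)

lemma isSOS_zero {n m : ℕ} : IsSOS (0 : PolyMatrix n m) := ⟨0, 0, by simp⟩

/-- Stacking the factors `H` and `K` vertically adds their Gram matrices. -/
lemma IsSOS.add {n m : ℕ} {S T : PolyMatrix n m} (hS : IsSOS S) (hT : IsSOS T) :
    IsSOS (S + T) := by
  obtain ⟨r, H, rfl⟩ := hS
  obtain ⟨q, K, rfl⟩ := hT
  refine ⟨r + q, (fromRows H K).submatrix finSumFinEquiv.symm id, ?_⟩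
  rw [transpose_submatrix, submatrix_mul_equiv, transpose_fromRows, fromCols_mul_fromRows,
    submatrix_id_id]

lemma isSOS_vecMulVec {n m : ℕ} (h : Fin m → MvPolynomial (Fin n) ℝ) :
    IsSOS (vecMulVec h h : PolyMatrix n m) := by
  refine ⟨1, of fun _ => h, ?_⟩
  ext i j
  simp [vecMulVec_apply, mul_apply]

lemma isSOSDecomposable_zero {n m t : ℕ} (C : Fin t → Finset (Fin m)) :
    IsSOSDecomposable C (0 : PolyMatrix n m) :=
  ⟨fun _ => 0, fun _ => isSOS_zero, by simp⟩

lemma IsSOSDecomposable.add {n m t : ℕ} {C : Fin t → Finset (Fin m)} {M N : PolyMatrix n m}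
    (hM : IsSOSDecomposable C M) (hN : IsSOSDecomposable C N) : IsSOSDecomposable C (M + N) := by
  obtain ⟨S, hS, rfl⟩ := hM
  obtain ⟨T, hT, rfl⟩ := hN
  refine ⟨fun k => S k + T k, fun k => (hS k).add (hT k), ?_⟩
  simp only [Matrix.mul_add, Matrix.add_mul, Finset.sum_add_distrib]

lemma isSOSDecomposable_sum {n m t : ℕ} {C : Fin t → Finset (Fin m)} {ι : Type*} (s : Finset ι)
    (M : ι → PolyMatrix n m) (hM : ∀ i ∈ s, IsSOSDecomposable C (M i)) :
    IsSOSDecomposable C (∑ i ∈ s, M i) :=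
  Finset.sum_induction M _ (fun _ _ => IsSOSDecomposable.add) (isSOSDecomposable_zero C) hM

lemma vecMul_inflation {R : Type*} [CommSemiring R] {m : ℕ} (D : Finset (Fin m)) (h : Fin m → R)
    (hD : ∀ i, h i ≠ 0 → i ∈ D) : (fun i => h (D.orderEmbOfFin rfl i)) ᵥ* inflation R D = h := by
  ext j
  simp only [vecMul, dotProduct, inflation, of_apply, mul_ite, mul_one, mul_zero]
  by_cases hj : j ∈ D
  · obtain ⟨i, hi⟩ : j ∈ Set.range (D.orderEmbOfFin rfl) := by simpa using hj
    rw [Finset.sum_eq_single i]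
    · simp [hi]
    · intro k _ hk
      rw [if_neg]
      intro h'
      exact hk ((D.orderEmbOfFin rfl).injective (h'.trans hi.symm))
    · simp
  · rw [Finset.sum_eq_zero, eq_comm]
    · by_contra h'
      exact hj (hD j h')
    · intro k _
      rw [if_neg]
      rintro rfl
      exact hj (Finset.orderEmbOfFin_mem D rfl k)

lemma isSOSDecomposable_vecMulVec {n m t : ℕ} {C : Fin t → Finset (Fin m)} (k : Fin t)
    (h : Fin m → MvPolynomial (Fin n) ℝ) (hk : ∀ i, h i ≠ 0 → i ∈ C k) :
    IsSOSDecomposable C (vecMulVec h h : PolyMatrix n m) := by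
  classical
  refine ⟨fun l => if l = k then vecMulVec (fun i => h ((C l).orderEmbOfFin rfl i))
    (fun i => h ((C l).orderEmbOfFin rfl i)) else 0, fun l => ?_, ?_⟩
  · dsimp only
    split_ifs
    · exact isSOS_vecMulVec _
    · exact isSOS_zero
  · rw [Finset.sum_eq_single k]
    · simp only [if_true]
      rw [mul_vecMulVec, vecMulVec_mul, mulVec_transpose, vecMul_inflation _ _ hk]
    · intro l _ hl
      simp [hl]
    · simp

lemma exists_isMaximalClique {m : ℕ} {G : SimpleGraph (Fin m)} {s : Set (Fin m)}
    (hs : G.IsClique s) : ∃ D : Finset (Fin m), IsMaximalClique G D ∧ s ⊆ D := by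
  classical
  obtain ⟨D, hle, hD⟩ :=
    (Set.toFinite {D : Finset (Fin m) | G.IsClique (D : Set (Fin m))}).exists_le_maximal
    (a := s.toFinite.toFinset) (by simpa using hs)
  exact ⟨D, hD, fun i hi => hle (by simpa using hi)⟩

/-- An even monomial times a positive semidefinite matrix with chordal sparsity is
decomposable. -/
lemma isSOSDecomposable_monomial {n m t : ℕ} {G : SimpleGraph (Fin m)}
    {C : Fin t → Finset (Fin m)} (hC : ∀ D, IsMaximalClique G D → ∃ k, C k = D)
    (α : Fin n →₀ ℕ) {A : Matrix (Fin m) (Fin m) ℝ}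
    (hA : A ∈ AddSubmonoid.closure (cliqueRankOnes ℝ G)) :
    IsSOSDecomposable C (A.map (MvPolynomial.monomial (2 • α)) : PolyMatrix n m) := by
  induction hA using AddSubmonoid.closure_induction with
  | mem A hA =>
    obtain ⟨w, hw, rfl⟩ := hA
    obtain ⟨D, hD, hwD⟩ := exists_isMaximalClique hw
    obtain ⟨k, rfl⟩ := hC D hD
    convert isSOSDecomposable_vecMulVec k (fun i => MvPolynomial.monomial α (w i)) ?_ using 1
    · ext i j : 1
      simp [vecMulVec_apply, MvPolynomial.monomial_mul, two_nsmul]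
    · intro i hi
      refine hwD fun h => hi ?_
      simp [h]
  | zero =>
    convert isSOSDecomposable_zero C using 1
    ext i j : 1
    simp
  | add A B _ _ ha hb =>
    convert ha.add hb using 1
    ext i j : 1
    simp

/-! ### Pólya's theorem for matrices -/

open Filter Topology

/-- The value of `q` at `u`, with the powers `uᵢ ^ βᵢ` replaced by the falling factorials
`uᵢ (uᵢ - c) ⋯ (uᵢ - (βᵢ - 1) c)` of step `c`. -/
noncomputable def fallingEval {n : ℕ} (q : MvPolynomial (Fin n) ℝ) (c : ℝ) (u : Fin n → ℝ) : ℝ :=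
  ∑ β ∈ q.support, q.coeff β * ∏ i, ∏ j ∈ Finset.range (β i), (u i - j * c)

lemma fallingEval_zero {n : ℕ} (q : MvPolynomial (Fin n) ℝ) (u : Fin n → ℝ) :
    fallingEval q 0 u = MvPolynomial.eval u q := by
  simp [fallingEval, MvPolynomial.eval_eq']

/-- Joint continuity in the step and the point lets positivity at step `0` persist, uniformly on a
compact set, for small steps. -/
lemma continuous_fallingEval {n : ℕ} (q : MvPolynomial (Fin n) ℝ) :
    Continuous fun z : ℝ × (Fin n → ℝ) => fallingEval q z.1 z.2 := by
  unfold fallingEval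
  fun_prop

/-- The coefficients of `(X₁ + ⋯ + Xₙ) ^ N * q` are values of the falling evaluation of `q`. -/
lemma coeff_sum_X_pow_mul {n : ℕ} {q : MvPolynomial (Fin n) ℝ} {e : ℕ} (hq : q.IsHomogeneous e)
    {N : ℕ} (hN : 0 < N) {α : Fin n →₀ ℕ} (hα : α.degree = N + e) :
    (∏ i, ((α i).factorial : ℝ)) * ((∑ i, MvPolynomial.X i) ^ N * q).coeff α =
      N.factorial * ((N + e : ℕ) : ℝ) ^ e *
        fallingEval q (1 / ((N + e : ℕ) : ℝ)) (fun i => α i / ((N + e : ℕ) : ℝ)) := by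
  have hM : ((N + e : ℕ) : ℝ) ≠ 0 := by positivity
  set M : ℝ := ((N + e : ℕ) : ℝ)
  conv_lhs => rw [q.as_sum, Finset.mul_sum, MvPolynomial.coeff_sum, Finset.mul_sum]
  rw [fallingEval, Finset.mul_sum]
  refine Finset.sum_congr rfl fun β hβ => ?_
  have hβe : β.degree = e := by
    rw [Finsupp.degree_eq_weight_one]
    exact hq (MvPolynomial.mem_support_iff.1 hβ)
  -- Since `β` has degree `e`, the factor `M ^ e` clears exactly one denominator per factor.
  have hfall : M ^ e * ∏ i, ∏ j ∈ Finset.range (β i), (α i / M - j * (1 / M)) =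
      ∏ i, ((α i).descFactorial (β i) : ℝ) := by
    rw [← hβe, Finsupp.degree_eq_sum, ← Finset.prod_pow_eq_pow_sum, ← Finset.prod_mul_distrib]
    refine Finset.prod_congr rfl fun i _ => ?_
    rw [← descPochhammer_eval_eq_descFactorial, descPochhammer_eval_eq_prod_range]
    conv_lhs => rw [← Finset.card_range (β i), ← Finset.prod_const, Finset.card_range,
      ← Finset.prod_mul_distrib]
    refine Finset.prod_congr rfl fun j _ => ?_
    field_simp
  have hrhs : ∀ r p : ℝ, (N.factorial : ℝ) * M ^ e * (r * p) = N.factorial * r * (M ^ e * p) :=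
    fun r p => by ring
  rw [hrhs, hfall, MvPolynomial.coeff_mul_monomial']
  split_ifs with hle
  · have hdeg : (α - β).degree = N := by
      have : (α - β).degree + β.degree = α.degree := by
        rw [← map_add, tsub_add_cancel_of_le hle]
      omega
    have hmult : (∏ i, (((α - β) i).factorial : ℝ)) * ((α - β).multinomial : ℝ) = N.factorial := by
      rw [Finsupp.multinomial_eq_of_support_subset (Finset.subset_univ _)]
      have := Nat.multinomial_spec Finset.univ (α - β)
      rw [← Finsupp.degree_eq_sum, hdeg] at this
      exact_mod_cast this
    have hfac : ∏ i, ((α i).factorial : ℝ) =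
        (∏ i, (((α - β) i).factorial : ℝ)) * ∏ i, ((α i).descFactorial (β i) : ℝ) := by
      rw [← Finset.prod_mul_distrib]
      refine Finset.prod_congr rfl fun i _ => ?_
      rw [Finsupp.tsub_apply]
      exact_mod_cast (Nat.factorial_mul_descFactorial (hle i)).symm
    rw [MvPolynomial.coeff_sum_X_pow_of_fintype, if_pos (by exact hdeg), hfac, ← hmult]
    ring
  -- If `β ≰ α`, the term contributes nothing, and a falling factorial vanishes as well.
  · obtain ⟨i, hi⟩ : ∃ i, α i < β i := by
      by_contra! h
      exact hle h
    have hz : ∏ i, ((α i).descFactorial (β i) : ℝ) = 0 :=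
      Finset.prod_eq_zero (Finset.mem_univ i) (by exact_mod_cast Nat.descFactorial_of_lt hi)
    rw [hz, mul_zero, mul_zero]

/-- **Pólya's theorem** for matrices: if the homogeneous symmetric matrix `Q` is positive
definite on the nonnegative orthant without the origin, then all coefficient matrices of
`(X₁ + ⋯ + Xₙ) ^ N * Q` are positive semidefinite for some `N`. -/
lemma exists_posSemidef_coeff {n m : ℕ} {Q : PolyMatrix n m} {e : ℕ} (hsym : Q.IsSymm)
    (hQ : ∀ i j, (Q i j).IsHomogeneous e)
    (hpos : ∀ u : Fin n → ℝ, 0 ≤ u → u ≠ 0 → (evalAt Q u).PosDef) :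
    ∃ N : ℕ, ∀ α : Fin n →₀ ℕ,
      (Matrix.of fun i j => ((∑ l, MvPolynomial.X l) ^ N * Q i j).coeff α).PosSemidef := by
  set F : ℝ → (Fin n → ℝ) × (Fin m → ℝ) → ℝ := fun c z =>
    ∑ i, ∑ j, z.2 i * z.2 j * fallingEval (Q i j) c z.1 with hF
  have hFc : Continuous fun y : ℝ × ((Fin n → ℝ) × (Fin m → ℝ)) => F y.1 y.2 := by
    refine continuous_finsetSum _ fun i _ => continuous_finsetSum _ fun j _ => ?_
    have h1 : Continuous fun y : ℝ × ((Fin n → ℝ) × (Fin m → ℝ)) =>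
        fallingEval (Q i j) y.1 y.2.1 :=
      (continuous_fallingEval (Q i j)).comp
        (f := fun y : ℝ × ((Fin n → ℝ) × (Fin m → ℝ)) => (y.1, y.2.1)) (by fun_prop)
    fun_prop
  have hcomp : IsCompact (stdSimplex ℝ (Fin n) ×ˢ Metric.sphere (0 : Fin m → ℝ) 1) :=
    (isCompact_stdSimplex ℝ (Fin n)).prod (isCompact_sphere _ _)
  have hev : ∀ᶠ c in 𝓝 (0 : ℝ), ∀ z ∈ stdSimplex ℝ (Fin n) ×ˢ Metric.sphere (0 : Fin m → ℝ) 1,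
      0 < F c z := by
    refine hcomp.eventually_forall_of_forall_eventually fun z hz => ?_
    refine hFc.continuousAt.eventually (lt_mem_nhds ?_)
    have hz1 : z.1 ≠ 0 := fun h => by
      have := hz.1.2
      simp [h] at this
    have hz2 : z.2 ≠ 0 := fun h => by
      have := hz.2
      simp [h] at this
    have := (hpos z.1 hz.1.1 hz1).dotProduct_mulVec_pos hz2
    simp only [hF, fallingEval_zero]
    simp only [star_trivial, dotProduct, mulVec, evalAt, map_apply, Finset.mul_sum] at this
    refine this.trans_eq (Finset.sum_congr rfl fun i _ => Finset.sum_congr rfl fun j _ => ?_)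
    ring
  -- The step is `1 / (N + e)`, small for large `N`; `0 < N` keeps the denominator nonzero even if
  -- `e = 0`.
  obtain ⟨N, hN, hNF⟩ : ∃ N : ℕ, 0 < N ∧
      ∀ z ∈ stdSimplex ℝ (Fin n) ×ˢ Metric.sphere (0 : Fin m → ℝ) 1,
        0 < F (1 / ((N + e : ℕ) : ℝ)) z := by
    have h1 : Tendsto (fun N : ℕ => 1 / ((N + e : ℕ) : ℝ)) atTop (𝓝 0) :=
      (tendsto_add_atTop_iff_nat e).2 tendsto_one_div_atTop_nhds_zero_nat
    exact ((eventually_gt_atTop 0).and (h1.eventually hev)).exists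
  refine ⟨N, fun α => ?_⟩
  by_cases hα : α.degree = N + e
  · refine posSemidef_iff_real.2 ⟨?_, fun v => ?_⟩
    · ext i j
      simp only [transpose_apply, of_apply, hsym.apply i j]
    · have hM : (0 : ℝ) < ((N + e : ℕ) : ℝ) := by positivity
      have hu : (fun i => (α i : ℝ) / ((N + e : ℕ) : ℝ)) ∈ stdSimplex ℝ (Fin n) := by
        refine ⟨fun i => by positivity, ?_⟩
        rw [← Finset.sum_div, div_eq_one_iff_eq hM.ne', ← hα, Finsupp.degree_eq_sum]
        push_cast
        rfl
      have hFv : 0 ≤ F (1 / ((N + e : ℕ) : ℝ)) (fun i => (α i : ℝ) / ((N + e : ℕ) : ℝ), v) := by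
        -- The form is quadratic in `v`, so `v` may be scaled to the unit sphere.
        rcases eq_or_ne v 0 with rfl | hv
        · simp [hF]
        · have hnv : ‖v‖ ≠ 0 := norm_ne_zero_iff.2 hv
          have h1 := hNF (_, ‖v‖⁻¹ • v) ⟨hu, by simp [norm_smul, hnv]⟩
          have h2 : F (1 / ((N + e : ℕ) : ℝ)) (fun i => (α i : ℝ) / ((N + e : ℕ) : ℝ), v) =
              ‖v‖ ^ 2 * F (1 / ((N + e : ℕ) : ℝ))
                (fun i => (α i : ℝ) / ((N + e : ℕ) : ℝ), ‖v‖⁻¹ • v) := by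
            simp only [hF, Finset.mul_sum, Pi.smul_apply, smul_eq_mul]
            refine Finset.sum_congr rfl fun i _ => Finset.sum_congr rfl fun j _ => ?_
            field_simp
          rw [h2]
          positivity
      have hfac : 0 < ∏ i, ((α i).factorial : ℝ) :=
        Finset.prod_pos fun i _ => by exact_mod_cast Nat.factorial_pos _
      refine (mul_nonneg_iff_of_pos_left hfac).1 ?_
      have : (∏ i, ((α i).factorial : ℝ)) * (v ⬝ᵥ
          (Matrix.of fun i j => ((∑ l, MvPolynomial.X l) ^ N * Q i j).coeff α) *ᵥ v) =
          N.factorial * ((N + e : ℕ) : ℝ) ^ e *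
            F (1 / ((N + e : ℕ) : ℝ)) (fun i => (α i : ℝ) / ((N + e : ℕ) : ℝ), v) := by
        simp only [hF, dotProduct, mulVec, of_apply, Finset.mul_sum]
        refine Finset.sum_congr rfl fun i _ => Finset.sum_congr rfl fun j _ => ?_
        have := coeff_sum_X_pow_mul (hQ i j) hN hα
        linear_combination (v i * v j) * this
      rw [this]
      positivity
  · have hzero : (Matrix.of fun i j => ((∑ l, MvPolynomial.X l) ^ N * Q i j).coeff α) =
        (0 : Matrix (Fin m) (Fin m) ℝ) := by
      ext i j
      rw [of_apply]
      have hhom : ((∑ l, MvPolynomial.X l) ^ N * Q i j).IsHomogeneous (N + e) := by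
        refine MvPolynomial.IsHomogeneous.mul ?_ (hQ i j)
        have := (MvPolynomial.IsHomogeneous.sum (R := ℝ) Finset.univ
          (fun l : Fin n => MvPolynomial.X l) 1 fun l _ => MvPolynomial.isHomogeneous_X ℝ l).pow N
        rwa [one_mul] at this
      exact hhom.coeff_eq_zero hα
    rw [hzero]
    exact PosSemidef.zero

/-! ### Even polynomials and substitution of squares -/

/-- A polynomial with even exponents only is a polynomial in the squares of the variables. -/
lemma exists_expand_two_eq {n : ℕ} {p : MvPolynomial (Fin n) ℝ}
    (hp : ∀ α ∈ p.support, ∀ l, Even (α l)) : ∃ q, MvPolynomial.expand 2 q = p := by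
  have h : ∀ α : Fin n →₀ ℕ, ∃ β : Fin n →₀ ℕ, α ∈ p.support → 2 • β = α := by
    intro α
    by_cases hα : α ∈ p.support
    · refine ⟨α.mapRange (· / 2) rfl, fun _ => ?_⟩
      ext l
      simpa using Nat.two_mul_div_two_of_even (hp α hα l)
    · exact ⟨0, fun h => (hα h).elim⟩
  choose β hβ using h
  refine ⟨∑ α ∈ p.support, MvPolynomial.monomial (β α) (p.coeff α), ?_⟩
  conv_rhs => rw [p.as_sum]
  rw [map_sum]
  refine Finset.sum_congr rfl fun α hα => ?_
  rw [MvPolynomial.expand_monomial, hβ α hα]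

/-- Any monomial of `q` doubles to degree `d`, so the division is exact unless `q = 0`, where
nothing is to be shown. -/
lemma isHomogeneous_of_expand_two {n d : ℕ} {q : MvPolynomial (Fin n) ℝ}
    (hq : (MvPolynomial.expand 2 q).IsHomogeneous d) : q.IsHomogeneous (d / 2) := by
  intro α hα
  rw [← MvPolynomial.coeff_expand_smul 2 two_ne_zero] at hα
  have := hq hα
  rw [map_nsmul, smul_eq_mul] at this
  omega

/-- Polynomials that agree away from the origin are equal. -/
lemma eq_of_eval_eq_of_ne_zero {n : ℕ} (hn : 0 < n) {p q : MvPolynomial (Fin n) ℝ}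
    (h : ∀ x : Fin n → ℝ, x ≠ 0 → MvPolynomial.eval x p = MvPolynomial.eval x q) : p = q := by
  -- Multiplying by a variable makes both sides agree at the origin too.
  refine mul_left_cancel₀ (MvPolynomial.X_ne_zero (⟨0, hn⟩ : Fin n))
    (MvPolynomial.funext fun x => ?_)
  rcases eq_or_ne x 0 with rfl | hx
  · simp
  · simp [h x hx]

end ChordalSOS

open ChordalSOS in
theorem mainTheorem3 (n m : ℕ) (P : ChordalSOS.PolyMatrix n m)
    (G : SimpleGraph (Fin m)) (hG : ChordalSOS.IsChordal G)
    (hsparse : ChordalSOS.HasSparsityGraph P G)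
    (t : ℕ) (C : Fin t → Finset (Fin m)) (hCinj : Function.Injective C)
    (hC : ∀ D : Finset (Fin m), ChordalSOS.IsMaximalClique G D ↔ ∃ k, C k = D)
    (hhom : ChordalSOS.IsHomogeneous P) (heven : ChordalSOS.IsEven P)
    (hpos : ∀ x : Fin n → ℝ, x ≠ 0 → (ChordalSOS.evalAt P x).PosDef) :
    ∃ (ν : ℕ) (S : (k : Fin t) → ChordalSOS.PolyMatrix n (C k).card),
      (∀ k, ChordalSOS.IsSOS (S k)) ∧
      (∑ i : Fin n, (MvPolynomial.X i : MvPolynomial (Fin n) ℝ) ^ 2) ^ ν • P =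
        ∑ k : Fin t,
          (ChordalSOS.inflation (MvPolynomial (Fin n) ℝ) (C k)).transpose * S k *
            ChordalSOS.inflation (MvPolynomial (Fin n) ℝ) (C k) := by
  rcases Nat.eq_zero_or_pos n with rfl | hn
  -- Without variables `hpos` is void, but the sum of squares is `0`, so exponent `1` kills the left
  -- side.
  · exact ⟨1, fun _ => 0, fun _ => isSOS_zero, by simp⟩
  obtain ⟨d, hd⟩ := hhom
  choose Q hQ using fun i j => exists_expand_two_eq (heven i j)
  have hexp : Function.Injective (MvPolynomial.expand 2 (R := ℝ) (σ := Fin n)) :=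
    MvPolynomial.expand_injective two_pos
  have hQhom : ∀ i j, (Q i j).IsHomogeneous (d / 2) := fun i j =>
    isHomogeneous_of_expand_two (by rw [hQ]; exact hd i j)
  have hQsym : (Matrix.of Q).IsSymm := by
    ext i j : 1
    refine hexp ?_
    simp only [Matrix.transpose_apply, Matrix.of_apply, hQ]
    exact eq_of_eval_eq_of_ne_zero hn fun x hx => (hpos x hx).1.apply i j
  have hQpos : ∀ u : Fin n → ℝ, 0 ≤ u → u ≠ 0 → (evalAt (Matrix.of Q) u).PosDef := by
    intro u hu hu0
    have hsq : (fun l => √(u l)) ^ 2 = u := by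
      ext l
      exact Real.sq_sqrt (hu l)
    have hx : (fun l => √(u l)) ≠ 0 := fun h => hu0 (by rw [← hsq, h, zero_pow two_ne_zero])
    convert hpos _ hx using 1
    ext i j
    simp only [evalAt, Matrix.map_apply, Matrix.of_apply]
    rw [← hQ, MvPolynomial.eval_expand, hsq]
  obtain ⟨N, hN⟩ := exists_posSemidef_coeff hQsym hQhom hQpos
  set R : PolyMatrix n m := Matrix.of fun i j => (∑ l, MvPolynomial.X l) ^ N * Q i j with hR
  have hRP : (∑ i : Fin n, (MvPolynomial.X i : MvPolynomial (Fin n) ℝ) ^ 2) ^ N • P =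
      R.map (MvPolynomial.expand 2) := by
    ext i j : 1
    simp [hR, hQ]
  classical
  set s : Finset (Fin n →₀ ℕ) := Finset.univ.biUnion fun i => Finset.univ.biUnion fun j =>
    (R i j).support with hs
  have hsum : R.map (MvPolynomial.expand 2) =
      ∑ α ∈ s, (R.map (MvPolynomial.coeff α)).map (MvPolynomial.monomial (2 • α)) := by
    ext i j : 1
    rw [Matrix.sum_apply, Matrix.map_apply]
    conv_lhs => rw [(R i j).as_sum]
    rw [map_sum]
    simp only [MvPolynomial.expand_monomial, Matrix.map_apply]
    refine Finset.sum_subset (fun α hα => ?_) fun α _ hα => ?_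
    · exact Finset.mem_biUnion.2 ⟨i, Finset.mem_univ _,
        Finset.mem_biUnion.2 ⟨j, Finset.mem_univ _, hα⟩⟩
    · rw [MvPolynomial.notMem_support_iff.1 hα, map_zero]
  obtain ⟨S, hS, hSsum⟩ : IsSOSDecomposable C
      ((∑ i : Fin n, (MvPolynomial.X i : MvPolynomial (Fin n) ℝ) ^ 2) ^ N • P) := by
    rw [hRP, hsum]
    refine isSOSDecomposable_sum _ _ fun α _ =>
      isSOSDecomposable_monomial (fun D hD => (hC D).1 hD) α ?_
    refine hG.mem_closure_cliqueRankOnes Finset.univ _ (hN α) (fun i j hij hadj => ?_)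
      fun i _ _ => Finset.mem_univ i
    -- The zero pattern passes from `P` to `Q` because substituting squares is injective.
    have : Q i j = 0 := hexp (by rw [hQ, hsparse i j hij hadj, map_zero])
    simp [hR, this]
  exact ⟨N, S, hS, hSsum⟩
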